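/- Let $m$ be the Lebesgue measure on the unit circle $\mathbb T$, normalized by $m(\mathbb T)=1$. For a finite positive Borel measure $\rho$ on $\mathbb T$ and $n\ge 1$ put $$e_n(\rho)=\min_{q_0,\dots,q_{n-1}\in\mathbb C}\Bigl(\int_{\mathbb T}\bigl|q_0+q_1t+\dots+q_{n-1}t^{n-1}+t^n\bigr|^2\,d\rho(t)\Bigr)^{1/2}.$$ For a measurable function $H\colon\mathbb T\to[0,+\infty]$ let $\lambda_H(a)=m\{t\in\mathbb T: H(t)>a\}$. For every $C>0$ there is $K>0$, depending only on $C$, such that the following holds. Let $H\colon\mathbb T\to[0,+\infty]$ be measurable and belong to the weak $L^1(m)$-space with constant $C$, that is, $\lambda_H(a)\le C/a$ for all $a\ge 1$. Let $\rho$ be a finite positive Borel measure on $\mathbb T$ with $d\rho\ge e^{-H}\,dm$ (where $e^{-\infty}=0$). Then $e_n(\rho)$ decays to zero no faster than the power $n^{-K}$: there is $c>0$ (which may depend on $H$ and $\rho$) such that $$e_n(\rho)\ge c\,n^{-K}\qquad\text{for all } n\ge 1.$$ -/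

import Mathlib

open MeasureTheory
open scoped ENNReal

/-- The unit circle carries its Borel σ-algebra. -/
noncomputable instance circleMeasurableSpace : MeasurableSpace Circle := borel Circle

instance circleBorelSpace : BorelSpace Circle := ⟨rfl⟩

/-- Lebesgue (arc length) measure `m` on the unit circle, normalized by `m(𝕋) = 1`: the image of
`dθ / 2π` on `(0, 2π]` under `θ ↦ exp (iθ)`. -/
noncomputable def circleLebesgue : Measure Circle :=
  Measure.map Circle.exp
    (ENNReal.ofReal (2 * Real.pi)⁻¹ • volume.restrict (Set.Ioc (0 : ℝ) (2 * Real.pi)))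

/-- The distribution function `λ_H(a) = m {H > a}` of `H : 𝕋 → [0, ∞]`, for `a ≥ 0`. -/
noncomputable def distribFun (H : Circle → ℝ≥0∞) (a : ℝ) : ℝ :=
  circleLebesgue.real {t | ENNReal.ofReal a < H t}

/-- The measure `e^{-H} dm`, where `e^{-∞} = 0`. -/
noncomputable def expNegMeasure (H : Circle → ℝ≥0∞) : Measure Circle :=
  circleLebesgue.withDensity fun t => EReal.exp (-(H t : EReal))

/-- `e_n(ρ)`: the minimum over `q_0, …, q_{n-1} ∈ ℂ` of
`(∫ |q_0 + q_1 t + ⋯ + q_{n-1} t^{n-1} + t^n|² dρ(t))^{1/2}`, that is, the distance in `L²(ρ)`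
from `t^n` to the polynomials of degree at most `n - 1`. -/
noncomputable def predError (ρ : Measure Circle) (n : ℕ) : ℝ :=
  ⨅ q : Fin n → ℂ,
    √(∫ t : Circle, ‖(∑ k : Fin n, q k * (t : ℂ) ^ (k : ℕ)) + (t : ℂ) ^ n‖ ^ 2 ∂ρ)

open Polynomial Real

/-! Let `P` be monic of degree `n`, `N = n + 1`, `F = ‖P‖ ^ 2` and `S = ∫ F dm`. Cut at the height
`a = 2DN`: the set `E = {H ≤ a}` misses measure at most `D / a = 1 / (2N)`, while `F ≤ N * S` on the
circle, so `E` carries at least half of `S`. Put `I = ∫_E F e^{-H} dm`. If `I < 1`, then `S ≤ 2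
e^a`, so `log (N * S)` is `O(N)` and `Eᶜ` contributes only `O(1)` to `∫ log F dm`. Since `P` is
monic, that integral is nonnegative, hence `∫_E log F` is bounded below independently of `n`. The
weak-type bound gives `∫_E H ≤ 1 + D log a`, and Jensen's inequality on `E` makes `I` at least a
constant times `a ^ (-2D)`; the square root gives the power `n ^ (-D)`. The core is
`exp_div_two_le_setIntegral_weighted`. -/

/-! ### Normalized Lebesgue measure on the circle. -/

theorem integral_circleLebesgue {f : Circle → ℝ} (hf : AEStronglyMeasurable f circleLebesgue) :
    ∫ t, f t ∂circleLebesgue = (2 * π)⁻¹ * ∫ θ in (0 : ℝ)..2 * π, f (Circle.exp θ) := by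
  rw [circleLebesgue, integral_map Circle.exp.continuous.measurable.aemeasurable hf,
    integral_smul_measure, intervalIntegral.integral_of_le (by positivity),
    ENNReal.toReal_ofReal (by positivity), smul_eq_mul]

theorem integrable_circleLebesgue_iff {f : Circle → ℝ} (hf : Measurable f) :
    Integrable f circleLebesgue ↔
      IntervalIntegrable (fun θ => f (Circle.exp θ)) volume 0 (2 * π) := by
  have h0 : ENNReal.ofReal (2 * π)⁻¹ ≠ 0 := by
    simpa using Real.pi_pos
  rw [circleLebesgue, integrable_map_measure hf.aestronglyMeasurable
      Circle.exp.continuous.measurable.aemeasurable,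
    integrable_smul_measure h0 ENNReal.ofReal_ne_top,
    intervalIntegrable_iff_integrableOn_Ioc_of_le (by positivity)]
  rfl

instance isProbabilityMeasure_circleLebesgue : IsProbabilityMeasure circleLebesgue := by
  refine ⟨?_⟩
  rw [circleLebesgue, Measure.map_apply Circle.exp.continuous.measurable MeasurableSet.univ]
  simp only [Set.preimage_univ, Measure.smul_apply, Measure.restrict_apply MeasurableSet.univ,
    Set.univ_inter, Real.volume_Ioc, sub_zero, smul_eq_mul]
  rw [← ENNReal.ofReal_mul (by positivity), inv_mul_cancel₀ (by positivity), ENNReal.ofReal_one]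

theorem circleLebesgue_singleton (z : Circle) : circleLebesgue {z} = 0 := by
  rw [circleLebesgue, Measure.map_apply Circle.exp.continuous.measurable (measurableSet_singleton z),
    Measure.smul_apply, Measure.restrict_apply
      (Circle.exp.continuous.measurable (measurableSet_singleton z))]
  have : (Circle.exp ⁻¹' {z} ∩ Set.Ioc 0 (2 * π)).Subsingleton := by
    rintro x ⟨hx, hx'⟩ y ⟨hy, hy'⟩
    obtain ⟨k, hk⟩ := Circle.exp_eq_exp.1 ((hx : Circle.exp x = z).trans (hy : _ = z).symm)
    have h1 : (k : ℝ) * (2 * π) < 1 * (2 * π) := by linarith [hx'.2, hy'.1]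
    have h2 : (-1 : ℝ) * (2 * π) < k * (2 * π) := by linarith [hx'.1, hy'.2]
    have h1' := lt_of_mul_lt_mul_right h1 (by positivity)
    have h2' := lt_of_mul_lt_mul_right h2 (by positivity)
    have : k = 0 := by
      have h3 : k < 1 := by exact_mod_cast h1'
      have h4 : -1 < k := by exact_mod_cast h2'
      omega
    simpa [this] using hk
  simp [this.measure_zero]

theorem ae_eval_ne_zero {P : ℂ[X]} (hP : P ≠ 0) :
    ∀ᵐ t : Circle ∂circleLebesgue, P.eval (t : ℂ) ≠ 0 := by
  have : {t : Circle | P.eval (t : ℂ) = 0}.Finite := by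
    refine Set.Finite.of_finite_image (f := ((↑) : Circle → ℂ))
      ((P.rootSet_finite ℂ).subset ?_) Circle.coe_injective.injOn
    rintro _ ⟨t, ht, rfl⟩
    simpa [mem_rootSet, hP] using ht
  have h0 : circleLebesgue {t : Circle | P.eval (t : ℂ) = 0} = 0 := by
    rw [← Set.biUnion_of_singleton {t : Circle | P.eval (t : ℂ) = 0},
      measure_biUnion_null_iff this.countable]
    exact fun z _ => circleLebesgue_singleton z
  simpa [ae_iff] using h0

theorem continuous_eval_circle (P : ℂ[X]) : Continuous fun t : Circle => P.eval (t : ℂ) :=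
  P.continuous.comp continuous_subtype_val

theorem circleMap_zero_one_eq_exp (θ : ℝ) : circleMap 0 1 θ = (Circle.exp θ : ℂ) := by
  simp [circleMap]

/-! ### Polynomials on the circle: Parseval, sup bound, Mahler measure. -/

theorem integral_norm_sq_eval (P : ℂ[X]) :
    ∫ t : Circle, ‖P.eval (t : ℂ)‖ ^ 2 ∂circleLebesgue = P.sum fun _ a => ‖a‖ ^ 2 := by
  have hm : Measurable fun t : Circle => ‖P.eval (t : ℂ)‖ ^ 2 :=
    ((continuous_eval_circle P).norm.pow 2).measurable
  rw [integral_circleLebesgue hm.aestronglyMeasurable, P.sum_def,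
    P.sum_sq_norm_coeff_eq_circleAverage, circleAverage_def]
  simp [circleMap_zero_one_eq_exp]

/-- Cauchy–Schwarz over the `natDegree + 1` coefficients, then Parseval. -/
theorem norm_sq_eval_le (P : ℂ[X]) (t : Circle) :
    ‖P.eval (t : ℂ)‖ ^ 2 ≤
      (P.natDegree + 1) * ∫ s : Circle, ‖P.eval (s : ℂ)‖ ^ 2 ∂circleLebesgue := by
  rw [integral_norm_sq_eval, eval_eq_sum_range,
    P.sum_over_range (fun _ => by simp)]
  calc ‖∑ i ∈ Finset.range (P.natDegree + 1), P.coeff i * (t : ℂ) ^ i‖ ^ 2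
      ≤ (∑ i ∈ Finset.range (P.natDegree + 1), ‖P.coeff i‖) ^ 2 := by
        gcongr
        exact (norm_sum_le _ _).trans (by simp [Circle.norm_coe])
    _ ≤ _ := by
        simpa using sq_sum_le_card_mul_sum_sq (s := Finset.range (P.natDegree + 1))
          (f := fun i => ‖P.coeff i‖)

theorem one_le_integral_norm_sq_eval {P : ℂ[X]} (hP : P.Monic) :
    1 ≤ ∫ s : Circle, ‖P.eval (s : ℂ)‖ ^ 2 ∂circleLebesgue := by
  rw [integral_norm_sq_eval, P.sum_over_range (fun _ => by simp)]
  calc (1 : ℝ) = ‖P.coeff P.natDegree‖ ^ 2 := by simp [hP]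
    _ ≤ _ := Finset.single_le_sum (f := fun i => ‖P.coeff i‖ ^ 2) (fun _ _ => by positivity)
        (Finset.self_mem_range_succ _)

theorem measurable_log_norm_eval (P : ℂ[X]) :
    Measurable fun t : Circle => log ‖P.eval (t : ℂ)‖ :=
  Real.measurable_log.comp (continuous_eval_circle P).norm.measurable

theorem integrable_log_norm_eval (P : ℂ[X]) :
    Integrable (fun t : Circle => log ‖P.eval (t : ℂ)‖) circleLebesgue := by
  rw [integrable_circleLebesgue_iff (measurable_log_norm_eval P)]
  simpa only [circleMap_zero_one_eq_exp] using P.intervalIntegrable_mahlerMeasure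

/-- A monic polynomial has Mahler measure at least 1, by Jensen's formula. -/
theorem integral_log_norm_eval_nonneg {P : ℂ[X]} (hP : P.Monic) :
    0 ≤ ∫ t : Circle, log ‖P.eval (t : ℂ)‖ ∂circleLebesgue := by
  have h1 : 0 ≤ P.logMahlerMeasure := by
    rw [logMahlerMeasure_eq_log_MahlerMeasure]
    exact log_nonneg (one_le_mahlerMeasure_of_one_le_norm_leadingCoeff (by simp [hP]))
  rw [integral_circleLebesgue (measurable_log_norm_eval P).aestronglyMeasurable]
  rw [logMahlerMeasure_def, circleAverage_def, smul_eq_mul] at h1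
  simpa only [circleMap_zero_one_eq_exp] using h1


/-! ### Truncated integral of a weak-type function. -/

theorem integrableOn_toReal_sublevel {H : Circle → ℝ≥0∞} (hH : Measurable H) {a : ℝ}
    (ha : 0 ≤ a) :
    IntegrableOn (fun t => (H t).toReal) {t | H t ≤ ENNReal.ofReal a} circleLebesgue := by
  refine Measure.integrableOn_of_bounded (M := a) (measure_ne_top _ _)
    hH.ennreal_toReal.aestronglyMeasurable ?_
  filter_upwards [ae_restrict_mem (measurableSet_le hH measurable_const)] with t ht
  rw [Real.norm_of_nonneg ENNReal.toReal_nonneg]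
  exact ENNReal.toReal_le_of_le_ofReal ha ht

/-- Layer-cake formula: the tail of the truncated function is at most 1 on `(0, 1]`, at most `D / s`
on `(1, a]`, and 0 beyond `a`. -/
theorem setIntegral_toReal_sublevel_le {H : Circle → ℝ≥0∞} (hH : Measurable H) {D a : ℝ}
    (ha : 1 ≤ a) (hD : ∀ s : ℝ, 1 ≤ s → distribFun H s ≤ D / s) :
    ∫ t in {t | H t ≤ ENNReal.ofReal a}, (H t).toReal ∂circleLebesgue ≤ 1 + D * log a := by
  have ha0 : 0 ≤ a := zero_le_one.trans ha
  have hE : MeasurableSet {t | H t ≤ ENNReal.ofReal a} := measurableSet_le hH measurable_const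
  set E := {t | H t ≤ ENNReal.ofReal a} with hEdef
  set f : Circle → ℝ := E.indicator fun t => (H t).toReal with hf
  have hfi : Integrable f circleLebesgue :=
    (integrable_indicator_iff hE).2 (integrableOn_toReal_sublevel hH ha0)
  have hf0 : 0 ≤ f := Set.indicator_nonneg fun _ _ => ENNReal.toReal_nonneg
  have hfa : f ≤ fun _ => a := fun t =>
    Set.indicator_le' (fun t ht => ENNReal.toReal_le_of_le_ofReal ha0 ht) (fun _ _ => ha0) t
  have hfd : ∀ s, 0 ≤ s → circleLebesgue.real {t | s < f t} ≤ distribFun H s := by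
    intro s hs
    refine measureReal_mono fun t ht => ?_
    have ht' : s < f t := ht
    by_cases htE : t ∈ E
    · rw [hf, Set.indicator_of_mem htE] at ht'
      exact (ENNReal.ofReal_lt_iff_lt_toReal hs (ne_top_of_le_ne_top ENNReal.ofReal_ne_top htE)).2
        ht'
    · rw [hf, Set.indicator_of_notMem htE] at ht'
      exact absurd ht' hs.not_gt
  have h01 : IntervalIntegrable (fun _ : ℝ => (1 : ℝ)) volume 0 1 := intervalIntegrable_const
  have h1a : IntervalIntegrable (fun s : ℝ => D / s) volume 1 a := by
    simp only [div_eq_mul_inv]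
    refine (intervalIntegral.intervalIntegrable_inv ?_ continuousOn_id).const_mul D
    intro x hx
    rw [Set.uIcc_of_le ha] at hx
    exact (zero_lt_one.trans_le hx.1).ne'
  have hg1 : IntegrableOn (fun _ : ℝ => (1 : ℝ)) (Set.Ioc 0 1) volume :=
    (intervalIntegrable_iff_integrableOn_Ioc_of_le zero_le_one).1 h01
  have hg2 : IntegrableOn (fun s : ℝ => D / s) (Set.Ioc 1 a) volume :=
    (intervalIntegrable_iff_integrableOn_Ioc_of_le ha).1 h1a
  set g1 : ℝ → ℝ := (Set.Ioc 0 1).indicator fun _ => 1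
  set g2 : ℝ → ℝ := (Set.Ioc 1 a).indicator fun s => D / s
  have hi1 : Integrable g1 volume := (integrable_indicator_iff measurableSet_Ioc).2 hg1
  have hi2 : Integrable g2 volume := (integrable_indicator_iff measurableSet_Ioc).2 hg2
  have hcmp : ∀ s ∈ Set.Ioi (0 : ℝ), circleLebesgue.real {t | s < f t} ≤ g1 s + g2 s := by
    intro s hs
    have hs : 0 < s := hs
    by_cases h1 : s ≤ 1
    · have e1 : g1 s = 1 := Set.indicator_of_mem (Set.mem_Ioc.2 ⟨hs, h1⟩) _
      have e2 : g2 s = 0 := Set.indicator_of_notMem (fun h => h.1.not_ge h1) _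
      rw [e1, e2, add_zero]
      exact measureReal_le_one
    · have e1 : g1 s = 0 := Set.indicator_of_notMem (fun h => h1 h.2) _
      rw [e1, zero_add]
      by_cases h2 : s ≤ a
      · have e2 : g2 s = D / s := Set.indicator_of_mem (Set.mem_Ioc.2 ⟨not_le.1 h1, h2⟩) _
        rw [e2]
        exact (hfd s hs.le).trans (hD s (not_le.1 h1).le)
      · have e2 : g2 s = 0 := Set.indicator_of_notMem (fun h => h2 h.2) _
        have e3 : {t | s < f t} = ∅ := by
          ext t
          simpa using (hfa t).trans (not_le.1 h2).le
        rw [e2, e3, measureReal_empty]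
  calc ∫ t in E, (H t).toReal ∂circleLebesgue
      = ∫ t, f t ∂circleLebesgue := (integral_indicator hE).symm
    _ = ∫ s in Set.Ioi 0, circleLebesgue.real {t | s < f t} :=
        hfi.integral_eq_integral_meas_lt (Filter.Eventually.of_forall hf0)
    _ ≤ ∫ s in Set.Ioi 0, (g1 s + g2 s) := by
        refine integral_mono_of_nonneg (Filter.Eventually.of_forall fun _ => measureReal_nonneg)
          (hi1.add hi2).integrableOn ?_
        exact (ae_restrict_iff' measurableSet_Ioi).2 (Filter.Eventually.of_forall hcmp)
    _ = ∫ s, (g1 s + g2 s) := by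
        refine setIntegral_eq_integral_of_forall_compl_eq_zero fun s hs => ?_
        have hs : s ≤ 0 := not_lt.1 hs
        have e1 : g1 s = 0 := Set.indicator_of_notMem (fun h => h.1.not_ge hs) _
        have e2 : g2 s = 0 :=
          Set.indicator_of_notMem (fun h => h.1.not_ge (hs.trans zero_le_one)) _
        rw [e1, e2, add_zero]
    _ = 1 + D * log a := by
        rw [integral_add hi1 hi2, integral_indicator measurableSet_Ioc,
          integral_indicator measurableSet_Ioc, ← intervalIntegral.integral_of_le zero_le_one,
          ← intervalIntegral.integral_of_le ha]
        simp only [div_eq_mul_inv]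
        rw [intervalIntegral.integral_const_mul, integral_inv_of_pos one_pos (by linarith)]
        simp

/-! ### Comparison of `ρ` with the truncated weight. -/

theorem integrable_norm_sq_eval (P : ℂ[X]) (μ : Measure Circle) [IsFiniteMeasure μ] :
    Integrable (fun t : Circle => ‖P.eval (t : ℂ)‖ ^ 2) μ :=
  BoundedContinuousFunction.integrable μ
    (BoundedContinuousFunction.mkOfCompact ⟨_, (continuous_eval_circle P).norm.pow 2⟩)

theorem integrableOn_weighted_norm_sq_eval (P : ℂ[X]) {H : Circle → ℝ≥0∞} (hH : Measurable H)
    (E : Set Circle) :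
    IntegrableOn (fun t : Circle => ‖P.eval (t : ℂ)‖ ^ 2 * rexp (-(H t).toReal)) E
      circleLebesgue := by
  refine ((integrable_norm_sq_eval P circleLebesgue).mul_bdd (c := 1)
    hH.ennreal_toReal.neg.exp.aestronglyMeasurable
    (Filter.Eventually.of_forall fun t => ?_)).integrableOn
  rw [Real.norm_of_nonneg (exp_pos _).le]
  exact exp_le_one_iff.2 (neg_nonpos.2 ENNReal.toReal_nonneg)

/-- Restricting to a sublevel set keeps `H` finite; where `H = ∞`, `toReal` is 0 and the real weight
would be 1 instead of 0. -/
theorem setIntegral_weighted_le_integral {H : Circle → ℝ≥0∞} (hH : Measurable H)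
    {ρ : Measure Circle} [IsFiniteMeasure ρ] (hρ : expNegMeasure H ≤ ρ) (P : ℂ[X]) {a : ℝ} :
    ∫ t in {t | H t ≤ ENNReal.ofReal a}, ‖P.eval (t : ℂ)‖ ^ 2 * rexp (-(H t).toReal)
      ∂circleLebesgue ≤ ∫ t, ‖P.eval (t : ℂ)‖ ^ 2 ∂ρ := by
  have hE : MeasurableSet {t | H t ≤ ENNReal.ofReal a} := measurableSet_le hH measurable_const
  have hval : ∀ t, H t ≤ ENNReal.ofReal a →
      (EReal.exp (-(H t : EReal))).toReal = rexp (-(H t).toReal) := by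
    intro t ht
    have htop : H t ≠ ∞ := ne_top_of_le_ne_top ENNReal.ofReal_ne_top ht
    have : (H t : EReal) = ((H t).toReal : ℝ) := (EReal.coe_ennreal_toReal htop).symm
    rw [this, ← EReal.coe_neg, EReal.exp_coe, ENNReal.toReal_ofReal (exp_pos _).le]
  have hle1 : ∀ t, EReal.exp (-(H t : EReal)) ≤ 1 := fun t => by
    rw [EReal.exp_le_one_iff, EReal.neg_le, neg_zero]
    exact EReal.coe_ennreal_nonneg _
  have hmeas : Measurable fun t => EReal.exp (-(H t : EReal)) :=
    (measurable_coe_ennreal_ereal.comp hH).neg.ereal_exp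
  have hint : Integrable
      (fun t : Circle => (EReal.exp (-(H t : EReal))).toReal * ‖P.eval (t : ℂ)‖ ^ 2)
      circleLebesgue := by
    refine (integrable_norm_sq_eval P circleLebesgue).bdd_mul (c := 1)
      hmeas.ennreal_toReal.aestronglyMeasurable (Filter.Eventually.of_forall fun t => ?_)
    rw [Real.norm_of_nonneg ENNReal.toReal_nonneg]
    exact ENNReal.toReal_le_of_le_ofReal zero_le_one (by simpa using hle1 t)
  calc ∫ t in {t | H t ≤ ENNReal.ofReal a}, ‖P.eval (t : ℂ)‖ ^ 2 * rexp (-(H t).toReal)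
        ∂circleLebesgue
      = ∫ t in {t | H t ≤ ENNReal.ofReal a},
          (EReal.exp (-(H t : EReal))).toReal * ‖P.eval (t : ℂ)‖ ^ 2 ∂circleLebesgue :=
        setIntegral_congr_fun hE fun t ht => by
          show ‖P.eval (t : ℂ)‖ ^ 2 * rexp (-(H t).toReal) = _
          rw [← hval t ht, mul_comm]
    _ ≤ ∫ t, (EReal.exp (-(H t : EReal))).toReal * ‖P.eval (t : ℂ)‖ ^ 2 ∂circleLebesgue :=
        setIntegral_le_integral hint (Filter.Eventually.of_forall fun t => by positivity)
    _ = ∫ t, ‖P.eval (t : ℂ)‖ ^ 2 ∂(expNegMeasure H) := by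
        rw [expNegMeasure, integral_withDensity_eq_integral_toReal_smul hmeas
          (Filter.Eventually.of_forall fun t => (hle1 t).trans_lt ENNReal.one_lt_top)]
        rfl
    _ ≤ ∫ t, ‖P.eval (t : ℂ)‖ ^ 2 ∂ρ :=
        integral_mono_measure hρ (Filter.Eventually.of_forall fun t => by positivity)
          (integrable_norm_sq_eval P ρ)

/-! ### The lower bound for monic polynomials. -/

/-- Jensen's inequality in the form used for the logarithmic integral. -/
theorem mul_exp_neg_ge {u h s : ℝ} (hu : 0 < u) :
    rexp s * (1 + (log u - h - s)) ≤ u * rexp (-h) := by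
  calc rexp s * (1 + (log u - h - s)) ≤ rexp s * rexp (log u - h - s) := by
        gcongr
        linarith [add_one_le_exp (log u - h - s)]
    _ = rexp (log u) * rexp (-h) := by rw [← exp_add, ← exp_add]; ring_nf
    _ = u * rexp (-h) := by rw [exp_log hu]

theorem exp_div_two_le_setIntegral_weighted {P : ℂ[X]} (hP : P.Monic) {H : Circle → ℝ≥0∞}
    (hH : Measurable H) {D : ℝ} (hD1 : 1 ≤ D)
    (hD : ∀ s : ℝ, 1 ≤ s → distribFun H s ≤ D / s) {a : ℝ}
    (haD : a = 2 * D * (P.natDegree + 1)) :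
    rexp (-2 * (2 + D + D * log a)) / 2 ≤
      ∫ t in {t | H t ≤ ENNReal.ofReal a}, ‖P.eval (t : ℂ)‖ ^ 2 * rexp (-(H t).toReal)
        ∂circleLebesgue := by
  set N : ℝ := P.natDegree + 1 with hN
  have hN1 : 1 ≤ N := by simp [hN]
  have ha : 1 ≤ a := by rw [haD]; nlinarith
  have ha0 : 0 < a := by linarith
  have hE : MeasurableSet {t | H t ≤ ENNReal.ofReal a} := measurableSet_le hH measurable_const
  have hHint := setIntegral_toReal_sublevel_le hH ha hD
  have hHi := integrableOn_toReal_sublevel hH ha0.le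
  have hEc : circleLebesgue.real {t | H t ≤ ENNReal.ofReal a}ᶜ ≤ 1 / (2 * N) := by
    have h1 : {t | H t ≤ ENNReal.ofReal a}ᶜ = {t | ENNReal.ofReal a < H t} := by
      ext t; simp
    rw [h1]
    refine (hD a ha).trans_eq ?_
    rw [haD]
    field_simp
  set E := {t | H t ≤ ENNReal.ofReal a} with hEdef
  set m := circleLebesgue with hm
  set F : Circle → ℝ := fun t => ‖P.eval (t : ℂ)‖ ^ 2 with hF
  set I := ∫ t in E, F t * rexp (-(H t).toReal) ∂m with hI
  set S := ∫ t, F t ∂m with hS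
  have hFi : Integrable F m := integrable_norm_sq_eval P m
  have hS1 : 1 ≤ S := one_le_integral_norm_sq_eval hP
  have hsup : ∀ t, F t ≤ N * S := norm_sq_eval_le P
  have hmE : 1 / 2 ≤ m.real E := by
    have h1 : 1 / (2 * N) ≤ 1 / 2 := by
      apply one_div_le_one_div_of_le <;> linarith
    have := probReal_add_probReal_compl (μ := m) hE
    linarith
  have hB0 : 0 ≤ 2 + D + D * log a := by
    have := log_nonneg ha
    positivity
  -- The claim is trivial for `I ≥ 1`; the opposite case supplies the a priori bound on `S`.
  by_cases hI1 : 1 ≤ I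
  · have : rexp (-2 * (2 + D + D * log a)) ≤ 1 := exp_le_one_iff.2 (by linarith)
    linarith
  -- Most of the `L²` mass of the polynomial lies on `E`.
  have hSE : S ≤ 2 * ∫ t in E, F t ∂m := by
    have h1 : ∫ t in Eᶜ, F t ∂m ≤ S / 2 := by
      calc ∫ t in Eᶜ, F t ∂m ≤ ∫ t in Eᶜ, N * S ∂m :=
            setIntegral_mono hFi.integrableOn integrableOn_const hsup
        _ = m.real Eᶜ * (N * S) := by rw [setIntegral_const, smul_eq_mul]
        _ ≤ 1 / (2 * N) * (N * S) := by gcongr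
        _ = S / 2 := by field_simp
    have h2 := integral_add_compl hE hFi
    linarith
  have hEI : ∫ t in E, F t ∂m ≤ rexp a * I := by
    rw [hI, ← integral_const_mul]
    refine setIntegral_mono_on hFi.integrableOn
      ((integrableOn_weighted_norm_sq_eval P hH E).const_mul _) hE fun t ht => ?_
    have h1 : (H t).toReal ≤ a := ENNReal.toReal_le_of_le_ofReal ha0.le ht
    calc F t = F t * 1 := (mul_one _).symm
      _ ≤ F t * rexp (a - (H t).toReal) := by
          gcongr
          exact one_le_exp (by linarith)
      _ = rexp a * (F t * rexp (-(H t).toReal)) := by rw [sub_eq_add_neg, exp_add]; ring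
  have hlogS : log (N * S) ≤ 2 * N * (1 + D) := by
    have h1 : N * S ≤ 2 * N * rexp a := by
      have : rexp a * I ≤ rexp a := mul_le_of_le_one_right (exp_pos _).le (not_le.1 hI1).le
      nlinarith
    calc log (N * S) ≤ log (2 * N * rexp a) := log_le_log (by positivity) h1
      _ = log (2 * N) + a := by rw [log_mul (by positivity) (exp_pos _).ne', log_exp]
      _ ≤ 2 * N + a := by
          have := log_le_self (show 0 ≤ 2 * N by positivity)
          linarith
      _ = 2 * N * (1 + D) := by rw [haD]; ring
  -- The sign is needed to replace `m.real Eᶜ` by its upper bound below.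
  have hlogS0 : 0 ≤ log (N * S) := log_nonneg (by nlinarith)
  have hLi : Integrable (fun t => log (F t)) m := by
    simpa [hF, log_pow] using (integrable_log_norm_eval P).const_mul 2
  have hL0 : 0 ≤ ∫ t, log (F t) ∂m := by
    have h1 := integral_log_norm_eval_nonneg hP
    have h2 : ∫ t, log (F t) ∂m = 2 * ∫ t : Circle, log ‖P.eval (t : ℂ)‖ ∂m := by
      rw [← integral_const_mul]
      simp [hF, log_pow]
    rw [h2]
    positivity
  -- Zeros of `P` must be discarded: there `log 0 = 0` and the tangent-line inequality fails to
  -- apply.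
  have hpos : ∀ᵐ t ∂m, 0 < F t := by
    filter_upwards [ae_eval_ne_zero hP.ne_zero] with t ht
    have := norm_pos_iff.2 ht
    positivity
  have hLE : -(1 + D) ≤ ∫ t in E, log (F t) ∂m := by
    have h1 : ∫ t in Eᶜ, log (F t) ∂m ≤ 1 + D := by
      calc ∫ t in Eᶜ, log (F t) ∂m ≤ ∫ t in Eᶜ, log (N * S) ∂m := by
            refine setIntegral_mono_ae hLi.integrableOn integrableOn_const ?_
            filter_upwards [hpos] with t ht
            exact log_le_log ht (hsup t)
        _ = m.real Eᶜ * log (N * S) := by rw [setIntegral_const, smul_eq_mul]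
        _ ≤ 1 / (2 * N) * (2 * N * (1 + D)) := by gcongr
        _ = 1 + D := by field_simp
    have h2 := integral_add_compl hE hLi
    linarith
  have hd : Integrable (fun t => log (F t) - (H t).toReal) (m.restrict E) :=
    hLi.integrableOn.sub hHi
  set B := 2 + D + D * log a with hB
  -- The mean of `log F - H` over `E` is at least `-B / m(E) ≥ -2B`, so the tangent to `exp` is
  -- taken at `-2B`.
  calc rexp (-2 * B) / 2 = rexp (-2 * B) * ((1 + 2 * B) * (1 / 2) - B) := by ring
    _ ≤ rexp (-2 * B) * ((1 + 2 * B) * m.real E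
          + (∫ t in E, log (F t) ∂m - ∫ t in E, (H t).toReal ∂m)) := by
        gcongr rexp (-2 * B) * ?_
        have : (1 + 2 * B) * (1 / 2) ≤ (1 + 2 * B) * m.real E := by gcongr
        linarith
    _ = ∫ t in E, rexp (-2 * B) * ((1 + 2 * B) + (log (F t) - (H t).toReal)) ∂m := by
        rw [integral_const_mul, integral_add (integrable_const _) hd,
          integral_sub hLi.integrableOn hHi, setIntegral_const, smul_eq_mul]
        ring
    _ ≤ I := by
        refine setIntegral_mono_ae
          ((Integrable.add (integrable_const _) hd).const_mul _)
          (integrableOn_weighted_norm_sq_eval P hH E) ?_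
        filter_upwards [hpos] with t ht
        refine le_trans (le_of_eq ?_) (mul_exp_neg_ge (s := -2 * B) (h := (H t).toReal) ht)
        ring

theorem le_predError {ρ : Measure Circle} {n : ℕ} {b : ℝ}
    (h : ∀ P : ℂ[X], P.Monic → P.natDegree = n → b ≤ √(∫ t, ‖P.eval (t : ℂ)‖ ^ 2 ∂ρ)) :
    b ≤ predError ρ n := by
  refine le_ciInf fun q => ?_
  have hdeg : (∑ k : Fin n, Polynomial.C (q k) * X ^ (k : ℕ)).degree < (n : WithBot ℕ) := by
    rw [← mem_degreeLT]
    refine Submodule.sum_mem _ fun k _ => mem_degreeLT.2 ?_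
    exact (degree_C_mul_X_pow_le _ _).trans_lt (by exact_mod_cast k.2)
  have hP := monic_X_pow_add hdeg
  have hn : (X ^ n + ∑ k : Fin n, C (q k) * X ^ (k : ℕ)).natDegree = n := by
    refine natDegree_eq_of_degree_eq_some ?_
    rw [degree_add_eq_left_of_degree_lt (by simpa using hdeg), degree_X_pow]
  simpa [eval_finsetSum, add_comm] using h _ hP hn

theorem mainTheorem8 (C : ℝ) (hC : 0 < C) :
    ∃ K : ℝ, 0 < K ∧
      ∀ (H : Circle → ℝ≥0∞) (ρ : Measure Circle), Measurable H → IsFiniteMeasure ρ →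
        (∀ a : ℝ, 1 ≤ a → distribFun H a ≤ C / a) →
        expNegMeasure H ≤ ρ →
        ∃ c : ℝ, 0 < c ∧ ∀ n : ℕ, 1 ≤ n → c * (n : ℝ) ^ (-K) ≤ predError ρ n := by
  refine ⟨C + 1, by linarith, fun H ρ hH _ hdist hρ => ?_⟩
  -- Enlarging `C` ensures `D ≥ 1`, so the cut height is at least 1, where the weak-type bound is
  -- available.
  set D := C + 1 with hDdef
  have hD1 : 1 ≤ D := by linarith
  have hD : ∀ s : ℝ, 1 ≤ s → distribFun H s ≤ D / s := fun s hs =>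
    (hdist s hs).trans (by gcongr; linarith)
  refine ⟨rexp (-(2 + D)) * (4 * D) ^ (-D) / 2, by positivity, fun n hn => ?_⟩
  have hn1 : (1 : ℝ) ≤ n := by exact_mod_cast hn
  refine le_predError fun P hP hPn => Real.le_sqrt_of_sq_le ?_
  refine le_trans ?_ ((exp_div_two_le_setIntegral_weighted hP hH hD1 hD rfl).trans
    (setIntegral_weighted_le_integral hH hρ P))
  rw [hPn]
  set a : ℝ := 2 * D * (n + 1)
  have ha0 : 0 < a := by positivity
  have ha : a ≤ 4 * D * n := by
    have : 0 ≤ D * (n - 1) := mul_nonneg (by linarith) (by linarith)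
    simp only [a]
    linarith
  have h1 : (4 * D) ^ (-D) * (n : ℝ) ^ (-D) ≤ a ^ (-D) := by
    rw [← mul_rpow (by positivity) (by positivity)]
    exact rpow_le_rpow_of_nonpos ha0 ha (by linarith)
  -- The factor 2 in the exponent is absorbed by the square root in `e_n`, leaving the power `-D`.
  have h2 : rexp (-2 * (2 + D + D * log a)) = (rexp (-(2 + D)) * a ^ (-D)) ^ 2 := by
    rw [rpow_def_of_pos ha0, ← exp_add, ← exp_nat_mul]
    congr 1
    push_cast
    ring
  rw [h2]
  calc (rexp (-(2 + D)) * (4 * D) ^ (-D) / 2 * (n : ℝ) ^ (-D)) ^ 2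
      = (rexp (-(2 + D)) * ((4 * D) ^ (-D) * (n : ℝ) ^ (-D))) ^ 2 / 4 := by ring
    _ ≤ (rexp (-(2 + D)) * a ^ (-D)) ^ 2 / 4 := by gcongr
    _ ≤ _ := by
        have := sq_nonneg (rexp (-(2 + D)) * a ^ (-D))
        linarith
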